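/- Let $m=(m_0,m_1,\dots)$ be a sequence of integers $m_k\ge 2$, put $M_0:=1$, $M_{k+1}:=m_kM_k$, and let $G_m:=\prod_{k\ge 0}\mathbb Z_{m_k}$ be the corresponding Vilenkin group with its normalized Haar measure $\mu$ (the product of the uniform measures). Every $n\in\mathbb N$ has a unique expansion $n=\sum_j n_jM_j$ with $0\le n_j<m_j$; let $r_k(x):=\exp(2\pi i x_k/m_k)$ and $\psi_n:=\prod_k r_k^{n_k}$ be the Vilenkin system. Let $\mathcal F_n$ be the $\sigma$-algebra generated by the sets $I_n(x):=\{y: y_0=x_0,\dots,y_{n-1}=x_{n-1}\}$, $x\in G_m$. The space $H_1(G_m)$ consists of the martingales $f=(f_n)_{n\in\mathbb N}$ with respect to $(\mathcal F_n)$ for which $\|f\|_{H_1}:=\big\|\sup_n|f_n|\big\|_1<\infty$; such an $f$ is identified with its almost everywhere limit, an integrable function (also denoted by $f$) with $f_n=E[f\mid\mathcal F_n]$ for all $n$. An integrable function $g$ is identified with the martingale $(S_{M_k}g)_k$. For a martingale $f$ put $\widehat f(i):=\lim_{k\to\infty}\int_{G_m}f_k\overline{\psi_i}\,d\mu$, $S_nf:=\sum_{i=0}^{n-1}\widehat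 f(i)\psi_i$, and let $$\omega(1/M_n,f)_{H_1}:=\|f-S_{M_n}f\|_{H_1}.$$ (a) Suppose that the sequence $m$ is bounded. If $f\in H_1(G_m)$ and $\omega(1/M_n,f)_{H_1}=o(1/n)$ as $n\to\infty$, then $\|S_kf-f\|_1\to 0$ as $k\to\infty$. (b) For every $m$ (bounded or not) there exists a martingale $f\in H_1(G_m)$ for which $\omega(1/M_{2M_n},f)_{H_1}=O(1/M_n)$ as $n\to\infty$, but $\|S_kf-f\|_1\not\to 0$ as $k\to\infty$. -/

import Mathlib

open MeasureTheory Filter Topology Asymptotics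
open scoped ENNReal

namespace Vilenkin

/-- The Vilenkin group `G_m`: the complete direct product of the cyclic groups `Z_{m_k}`. -/
abbrev G (m : ℕ → ℕ) : Type := ∀ k, ZMod (m k)

/-- The direct product of the uniform measures `μ_k({j}) = 1 / m_k`
(the normalized Haar measure of `G_m`). -/
noncomputable def μ (m : ℕ → ℕ) : Measure (G m) :=
  Measure.infinitePi fun k => ProbabilityTheory.uniformOn (Set.univ : Set (ZMod (m k)))

/-- The generalized powers: `M_0 = 1`, `M_{k+1} = m_k M_k`. -/
def M (m : ℕ → ℕ) : ℕ → ℕ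
  | 0 => 1
  | k + 1 => m k * M m k

/-- The digit `n_j` in the expansion `n = ∑ n_j M_j`, `n_j ∈ {0, …, m_j - 1}`. -/
def digit (m : ℕ → ℕ) (n j : ℕ) : ℕ := n / M m j % m j

/-- The generalized Rademacher function `r_k(x) = exp(2πi x_k / m_k)`. -/
noncomputable def rademacher (m : ℕ → ℕ) (k : ℕ) (x : G m) : ℂ :=
  Complex.exp (2 * Real.pi * Complex.I * ((x k).val : ℂ) / (m k : ℂ))

/-- The Vilenkin function `ψ_n = ∏_k r_k ^ n_k`. The factors with `k ≥ n` are omitted: there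
`n < 2 ^ k ≤ M_k`, so that `n_k = 0` (all `m_j` being at least `2`). -/
noncomputable def psi (m : ℕ → ℕ) (n : ℕ) (x : G m) : ℂ :=
  ∏ k ∈ Finset.range n, rademacher m k x ^ digit m n k

/-- The interval `I_n(x)` of all `y` whose first `n` coordinates agree with those of `x`. -/
def interval (m : ℕ → ℕ) (n : ℕ) (x : G m) : Set (G m) := {y | ∀ i < n, y i = x i}

/-- The σ-algebra generated by the intervals `I_n(x)`, `x ∈ G_m`. -/
abbrev sigma (m : ℕ → ℕ) (n : ℕ) : MeasurableSpace (G m) :=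
  MeasurableSpace.generateFrom (Set.range (interval m n))

theorem sigma_le (m : ℕ → ℕ) (n : ℕ) : sigma m n ≤ MeasurableSpace.pi := by
  refine MeasurableSpace.generateFrom_le ?_
  rintro _ ⟨x, rfl⟩
  have h : interval m n x = ⋂ i ∈ Set.Iio n, (fun y : G m => y i) ⁻¹' {x i} := by
    ext y; simp [interval]
  rw [h]
  exact MeasurableSet.biInter (Set.to_countable _) fun i _ =>
    measurable_pi_apply i (MeasurableSpace.measurableSet_top (s := {x i}))

theorem sigma_mono (m : ℕ → ℕ) : Monotone (sigma m) := by
  intro n n' hn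
  refine MeasurableSpace.generateFrom_le ?_
  rintro _ ⟨x, rfl⟩
  have h : interval m n x = ⋃₀ (interval m n' '' interval m n x) := by
    ext y
    simp only [Set.mem_sUnion, Set.mem_image]
    constructor
    · intro hy
      exact ⟨_, ⟨y, hy, rfl⟩, fun i _ => rfl⟩
    · rintro ⟨_, ⟨z, hz, rfl⟩, hy⟩ i hi
      exact (hy i (hi.trans_le hn)).trans (hz i hi)
  have hc : (Set.range (interval m n')).Countable := by
    have hsub : Set.range (interval m n') ⊆ Set.range
        (fun z : (∀ i : Fin n', ZMod (m i)) => {y : G m | ∀ i : Fin n', y i = z i}) := by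
      rintro _ ⟨x, rfl⟩
      refine ⟨fun i => x i, ?_⟩
      ext y
      exact ⟨fun hy i hi => hy ⟨i, hi⟩, fun hy i => hy i i.2⟩
    have hz : ∀ k, Countable (ZMod k) := fun k => by
      cases k
      · exact inferInstanceAs (Countable ℤ)
      · exact inferInstanceAs (Countable (Fin _))
    exact Set.Countable.mono hsub (Set.countable_range _)
  rw [h]
  refine MeasurableSet.sUnion (hc.mono (Set.image_subset_range _ _)) ?_
  rintro _ ⟨z, _, rfl⟩
  exact MeasurableSpace.measurableSet_generateFrom ⟨z, rfl⟩

/-- The filtration of the σ-algebras generated by the intervals of rank `n`. -/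
def filtration (m : ℕ → ℕ) : Filtration ℕ (MeasurableSpace.pi : MeasurableSpace (G m)) where
  seq := sigma m
  mono' := sigma_mono m
  le' := sigma_le m

/-- The `i`-th Vilenkin–Fourier coefficient of an integrable function. -/
noncomputable def coeffFun (m : ℕ → ℕ) (g : G m → ℂ) (i : ℕ) : ℂ :=
  ∫ x, g x * (starRingEnd ℂ) (psi m i x) ∂μ m

/-- The `i`-th Vilenkin–Fourier coefficient of a martingale, `lim_k ∫ f_k conj(ψ_i) dμ`
(the sequence is eventually constant). -/
noncomputable def coeff (m : ℕ → ℕ) (f : ℕ → G m → ℂ) (i : ℕ) : ℂ :=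
  limUnder atTop fun k => coeffFun m (f k) i

/-- The partial sum `S_n g = ∑_{k < n} ĝ(k) ψ_k` of an integrable function. -/
noncomputable def partialSumFun (m : ℕ → ℕ) (n : ℕ) (g : G m → ℂ) (x : G m) : ℂ :=
  ∑ k ∈ Finset.range n, coeffFun m g k * psi m k x

/-- The partial sum `S_n f = ∑_{k < n} f̂(k) ψ_k` of a martingale. -/
noncomputable def partialSum (m : ℕ → ℕ) (n : ℕ) (f : ℕ → G m → ℂ) (x : G m) : ℂ :=
  ∑ k ∈ Finset.range n, coeff m f k * psi m k x

/-- The martingale `(S_{M_k} g)_k` obtained from an integrable function `g`. -/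
noncomputable def toMartingale (m : ℕ → ℕ) (g : G m → ℂ) (k : ℕ) : G m → ℂ :=
  partialSumFun m (M m k) g

/-- The maximal function `f^* = sup_n |f_n|`, with values in `[0, ∞]`. -/
noncomputable def maximal (m : ℕ → ℕ) (f : ℕ → G m → ℂ) (x : G m) : ℝ≥0∞ := ⨆ n, ‖f n x‖ₑ

/-- The Hardy norm `‖f‖_{H_1} = ‖f^*‖_1`, with values in `[0, ∞]`. -/
noncomputable def hardyNorm (m : ℕ → ℕ) (f : ℕ → G m → ℂ) : ℝ≥0∞ := ∫⁻ x, maximal m f x ∂μ m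

/-- Membership in the martingale Hardy space `H_1(G_m)`. -/
def MemHardy (m : ℕ → ℕ) (f : ℕ → G m → ℂ) : Prop :=
  Martingale f (filtration m) (μ m) ∧ hardyNorm m f < ∞

/-- The modulus of continuity `ω(1 / M_n, f)_{H_1} = ‖f - S_{M_n} f‖_{H_1}`, the function
`S_{M_n} f` being regarded as a martingale. -/
noncomputable def modulus (m : ℕ → ℕ) (n : ℕ) (f : ℕ → G m → ℂ) : ℝ≥0∞ :=
  hardyNorm m fun k x => f k x - toMartingale m (partialSum m (M m n) f) k x

/-- The pointwise limit `lim_n f_n(x)` of a martingale (used where it exists almost everywhere). -/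
noncomputable def limit (m : ℕ → ℕ) (f : ℕ → G m → ℂ) (x : G m) : ℂ :=
  limUnder atTop fun n => f n x

/-- `F` is the function of `L_1(G_m)` with which the martingale `f` is identified:
`F` is integrable, `f_n → F` almost everywhere, and `f_n` is the conditional expectation of `F`. -/
def Represents (m : ℕ → ℕ) (F : G m → ℂ) (f : ℕ → G m → ℂ) : Prop :=
  MemLp F 1 (μ m) ∧ (∀ᵐ x ∂μ m, Tendsto (fun n => f n x) atTop (𝓝 (F x))) ∧
    ∀ n, (μ m)[F | filtration m n] =ᵐ[μ m] f n

end Vilenkin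

/-!
The Dirichlet kernel `D_{M_n}` equals `M_n` on `I_n(0)` and vanishes elsewhere, so `S_{M_n}` is the
conditional expectation given `F_n`. Splitting `S_n` along the digits of `n` bounds its norm on
`L_1` by `∑ n_j`. For `M_N ≤ k < M_{N+1}` the operator `S_k` fixes `f_N = S_{M_N} f`, and applying
the bound to `f_{N+1} - f_N` shows that `‖S_k f - f‖_1 ≤ (∑_{j ≤ N} m_j) ω(1/M_N, f)`; for bounded
`m` the sum is `O(N)`.

For the counterexample, let `f` be the sum over `k` of the blocks `D_{M_{j+1}} - D_{M_j}` with
`j = 2 M_k`, weighted by `1 / M_k`. The blocks have norm at most `2`, so the moduli of continuity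
are bounded by tails of `∑ 1 / M_k`. For `q = ∑_{i < M_k} (m_{2i} - 1) M_{2i}` the difference
`S_{M_j + q} f - S_{M_j} f` has modulus `|D_q| / M_k`, and `‖D_q‖_1 ≥ M_k / 4`, because `|D_q|` is
at least `M_{2i+1} / 2` on each shell `I_{2i+1}(0) \ I_{2i+2}(0)` with `i < M_k`.
-/

section MartingaleConvergence

variable {Ω E : Type*} {m₀ : MeasurableSpace Ω} {P : Measure Ω} [NormedAddCommGroup E]

theorem tendsto_eLpNorm_sub_comp {ι κ : Type*} {l : Filter ι} {l' : Filter κ} {p : ℝ≥0∞}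
    (hp : 1 ≤ p) {u : ι → Ω → E} {F : Ω → E} (hu : ∀ i, AEStronglyMeasurable (u i) P)
    (hF : AEStronglyMeasurable F P) (h : Tendsto (fun i => eLpNorm (u i - F) p P) l (𝓝 0))
    {φ ψ : κ → ι} (hφ : Tendsto φ l' l) (hψ : Tendsto ψ l' l) :
    Tendsto (fun k => eLpNorm (u (φ k) - u (ψ k)) p P) l' (𝓝 0) := by
  refine tendsto_of_tendsto_of_tendsto_of_le_of_le tendsto_const_nhds
    (by simpa using (h.comp hφ).add (h.comp hψ)) (fun _ => zero_le) fun k => ?_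
  calc eLpNorm (u (φ k) - u (ψ k)) p P = eLpNorm ((u (φ k) - F) - (u (ψ k) - F)) p P := by
        rw [sub_sub_sub_cancel_right]
    _ ≤ eLpNorm (u (φ k) - F) p P + eLpNorm (u (ψ k) - F) p P :=
        eLpNorm_sub_le ((hu _).sub hF) ((hu _).sub hF) hp

variable [NormedSpace ℝ E] [CompleteSpace E]

theorem martingale_clm_comp {ι E' : Type*} [Preorder ι] [NormedAddCommGroup E'] [NormedSpace ℝ E']
    [CompleteSpace E'] {ℱ : Filtration ι m₀} {f : ι → Ω → E} (T : E →L[ℝ] E')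
    (hf : Martingale f ℱ P) : Martingale (fun i => T ∘ f i) ℱ P := by
  refine ⟨fun i => T.continuous.comp_stronglyMeasurable (hf.1 i), fun i j hij => ?_⟩
  filter_upwards [T.comp_condExp_comm (m := ℱ i) (hf.integrable j), hf.2 i j hij] with ω hT hω
  rw [← hT, Function.comp_apply, hω, Function.comp_apply]

variable {ℱ : Filtration ℕ m₀} {f : ℕ → Ω → E}

theorem martingale_exists_ae_tendsto_of_bdd [FiniteDimensional ℝ E] [IsFiniteMeasure P]
    (hf : Martingale f ℱ P) {R : NNReal} (hR : ∀ n, eLpNorm (f n) 1 P ≤ R) :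
    ∀ᵐ ω ∂P, ∃ c, Tendsto (fun n => f n ω) atTop (𝓝 c) := by
  let e := (Module.finBasis ℝ E).equivFunL
  have hcoord (i) : ∀ᵐ ω ∂P, ∃ c, Tendsto (fun n => e (f n ω) i) atTop (𝓝 c) := by
    let T : E →L[ℝ] ℝ := (ContinuousLinearMap.proj i).comp e.toContinuousLinearMap
    refine (martingale_clm_comp T hf).submartingale.exists_ae_tendsto_of_bdd
      (R := ‖T‖₊ * R) fun n => ?_
    calc eLpNorm (T ∘ f n) 1 P ≤ ‖T‖₊ • eLpNorm (f n) 1 P :=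
          eLpNorm_le_nnreal_smul_eLpNorm_of_ae_le_mul (ae_of_all _ fun ω => T.le_opNNNorm _) 1
      _ ≤ ↑(‖T‖₊ * R) := by
          rw [ENNReal.coe_mul, ENNReal.smul_def, smul_eq_mul]
          gcongr
          exact hR n
  filter_upwards [ae_all_iff.2 hcoord] with ω hω
  choose c hc using hω
  exact ⟨e.symm c, by
    simpa [Function.comp_def] using (e.symm.continuous.tendsto c).comp (tendsto_pi_nhds.2 hc)⟩

theorem martingale_ae_eq_condExp_of_dominated [IsFiniteMeasure P] (hf : Martingale f ℱ P)
    {F : Ω → E} {bound : Ω → ℝ} (hbound : Integrable bound P)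
    (hle : ∀ n, ∀ᵐ ω ∂P, ‖f n ω‖ ≤ bound ω)
    (hlim : ∀ᵐ ω ∂P, Tendsto (fun n => f n ω) atTop (𝓝 (F ω))) (n : ℕ) :
    P[F | ℱ n] =ᵐ[P] f n := by
  have hself : P[f n | ℱ n] = f n :=
    condExp_of_stronglyMeasurable (ℱ.le n) (hf.1 n) (hf.integrable n)
  have hcond := tendsto_condExp_unique (m := ℱ n) (fun k => f (k + n)) (fun _ => f n) F (f n)
    (fun _ => hf.integrable _) (fun _ => hf.integrable n)
    (hlim.mono fun ω hω => hω.comp (tendsto_add_atTop_nat n))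
    (ae_of_all _ fun _ => tendsto_const_nhds) bound hbound bound hbound (fun _ => hle _)
    (fun _ => hle n) fun k => by rw [hself]; exact hf.2 n (k + n) (Nat.le_add_left _ _)
  rwa [hself] at hcond

end MartingaleConvergence

theorem tsum_extend_strictMono_add {R : Type*} [AddCommMonoid R] [TopologicalSpace R]
    {s : ℕ → ℕ} (hs : StrictMono s) (b : ℕ → R) (n : ℕ) :
    ∑' j, Function.extend s b 0 (s n + j) = ∑' k, b (n + k) := by
  let t : ℕ → ℕ := fun k => s (n + k) - s n
  have ht (k : ℕ) : s n + t k = s (n + k) :=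
    Nat.add_sub_cancel' (hs.monotone (Nat.le_add_right n k))
  have ht_inj : Function.Injective t := fun k l hkl => by
    have := hs.injective ((ht k).symm.trans ((congrArg (s n + ·) hkl).trans (ht l)))
    omega
  rw [← tsum_extend_zero ht_inj fun k => b (n + k)]
  refine tsum_congr fun j => ?_
  by_cases hj : ∃ k, t k = j
  · obtain ⟨k, rfl⟩ := hj
    rw [ht_inj.extend_apply, ht, hs.injective.extend_apply]
  · rw [Function.extend_apply' _ _ _ hj, Function.extend_apply', Pi.zero_apply, Pi.zero_apply]
    rintro ⟨k, hk⟩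
    have hnk : n ≤ k := hs.le_iff_le.1 (by omega)
    exact hj ⟨k - n, by simp only [t, Nat.add_sub_cancel' hnk]; omega⟩

namespace Vilenkin

variable {m : ℕ → ℕ}

section Digits

theorem M_succ (m : ℕ → ℕ) (k : ℕ) : M m (k + 1) = m k * M m k := rfl

theorem M_eq_prod (m : ℕ → ℕ) (n : ℕ) : M m n = ∏ k ∈ Finset.range n, m k := by
  induction n with
  | zero => rfl
  | succ n ih => rw [M_succ, ih, Finset.prod_range_succ, mul_comm]

theorem M_dvd (m : ℕ → ℕ) {j k : ℕ} (h : j ≤ k) : M m j ∣ M m k := by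
  rw [M_eq_prod, M_eq_prod]
  exact Finset.prod_dvd_prod_of_subset _ _ _ (Finset.range_mono h)

theorem digit_eq_zero {n j : ℕ} (h : n < M m j) : digit m n j = 0 := by
  simp [digit, Nat.div_eq_of_lt h]

theorem digit_lt [∀ k, NeZero (m k)] (n j : ℕ) : digit m n j < m j :=
  Nat.mod_lt _ (NeZero.pos _)

instance neZero_M [∀ k, NeZero (m k)] (k : ℕ) : NeZero (M m k) := by
  induction k with
  | zero => exact ⟨one_ne_zero⟩
  | succ k ih => exact ⟨mul_ne_zero (NeZero.ne _) ih.out⟩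

theorem M_pos [∀ k, NeZero (m k)] (k : ℕ) : 0 < M m k := NeZero.pos _

theorem digit_mul_M_add_of_lt [∀ k, NeZero (m k)] {j l : ℕ} (h : l < j) (c i : ℕ) :
    digit m (c * M m j + i) l = digit m i l := by
  obtain ⟨q, hq⟩ := M_dvd m (Nat.succ_le_of_lt h)
  have hsum : c * M m j + i = i + M m l * (m l * (c * q)) := by
    rw [hq, M_succ]; ring
  rw [digit, digit, hsum, Nat.add_mul_div_left _ _ (M_pos l), Nat.add_mul_mod_self_left]

theorem digit_mul_M_of_lt [∀ k, NeZero (m k)] {j l : ℕ} (h : l < j) (c : ℕ) :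
    digit m (c * M m j) l = 0 := by
  simpa [digit] using digit_mul_M_add_of_lt h c 0

theorem digit_mul_M_add_of_le [∀ k, NeZero (m k)] {j l : ℕ} (h : j ≤ l) (c : ℕ) {i : ℕ}
    (hi : i < M m j) : digit m (c * M m j + i) l = digit m (c * M m j) l := by
  obtain ⟨q, hq⟩ := M_dvd m h
  have hdiv : (c * M m j + i) / M m j = c := by
    rw [add_comm, Nat.add_mul_div_right _ _ (M_pos j), Nat.div_eq_of_lt hi, zero_add]
  rw [digit, digit, hq, ← Nat.div_div_eq_div_mul, ← Nat.div_div_eq_div_mul, hdiv,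
    Nat.mul_div_cancel _ (M_pos j)]

theorem digit_mul_M_self [∀ k, NeZero (m k)] {a k : ℕ} (ha : a < m k) :
    digit m (a * M m k) k = a := by
  rw [digit, Nat.mul_div_cancel _ (M_pos k), Nat.mod_eq_of_lt ha]

variable [∀ k, (m k).AtLeastTwo]

theorem two_mul_M_le (k : ℕ) : 2 * M m k ≤ M m (k + 1) :=
  Nat.mul_le_mul_right _ Nat.AtLeastTwo.prop

theorem M_strictMono : StrictMono (M m) :=
  strictMono_nat_of_lt_succ fun k => by
    have := two_mul_M_le (m := m) k
    have := M_pos (m := m) k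
    omega

theorem lt_M (k : ℕ) : k < M m k := by
  induction k with
  | zero => exact Nat.one_pos
  | succ k ih => have := two_mul_M_le (m := m) k; omega

end Digits

section Characters

theorem psi_zero (m : ℕ → ℕ) (x : G m) : psi m 0 x = 1 := by simp [psi]

theorem measurable_psi (m : ℕ → ℕ) (n : ℕ) : Measurable (psi m n) :=
  Finset.measurable_prod _ fun k _ => Measurable.pow_const
    ((measurable_from_top (f := fun z : ZMod (m k) =>
      Complex.exp (2 * Real.pi * Complex.I * (z.val : ℂ) / (m k : ℂ)))).comp
      (measurable_pi_apply k)) _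

section NeZero

variable [∀ k, NeZero (m k)]

theorem rademacher_eq_toCircle (k : ℕ) (x : G m) :
    rademacher m k x = (ZMod.toCircle (x k) : ℂ) := by
  rw [ZMod.toCircle_apply, rademacher]

theorem norm_rademacher (k : ℕ) (x : G m) : ‖rademacher m k x‖ = 1 := by
  rw [rademacher_eq_toCircle, Circle.norm_coe]

theorem rademacher_sub (k : ℕ) (x y : G m) :
    rademacher m k (x - y) = rademacher m k x * (starRingEnd ℂ) (rademacher m k y) := by
  simp only [rademacher_eq_toCircle, Pi.sub_apply, AddChar.map_sub_eq_div,
    ← Circle.coe_inv_eq_conj, div_eq_mul_inv, Circle.coe_mul]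

theorem sum_rademacher_pow (k : ℕ) (x : G m) :
    ∑ a ∈ Finset.range (m k), rademacher m k x ^ a = if x k = 0 then (m k : ℂ) else 0 := by
  rw [rademacher_eq_toCircle]
  split_ifs with h
  · simp [h]
  · have hne : (ZMod.toCircle (x k) : ℂ) ≠ 1 := fun h1 =>
      h (ZMod.injective_toCircle (by simpa using Circle.ext h1))
    have hpow : (ZMod.toCircle (x k) : ℂ) ^ m k = 1 := by
      simp [← Circle.coe_pow, ← AddChar.map_nsmul_eq_pow]
    rw [geom_sum_eq hne, hpow, sub_self, zero_div]

theorem norm_psi (n : ℕ) (x : G m) : ‖psi m n x‖ = 1 := by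
  simp [psi, norm_rademacher]

theorem psi_mul_conj (n : ℕ) (x : G m) : psi m n x * (starRingEnd ℂ) (psi m n x) = 1 := by
  simp [Complex.mul_conj, Complex.normSq_eq_norm_sq, norm_psi]

theorem psi_sub (n : ℕ) (x y : G m) :
    psi m n (x - y) = psi m n x * (starRingEnd ℂ) (psi m n y) := by
  simp only [psi, rademacher_sub, mul_pow, Finset.prod_mul_distrib, map_prod, map_pow]

end NeZero

variable [∀ k, (m k).AtLeastTwo]

theorem psi_eq_prod {n K : ℕ} (h : n < M m K) (x : G m) :
    psi m n x = ∏ k ∈ Finset.range K, rademacher m k x ^ digit m n k := by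
  have hone {L : ℕ} (hL : n < M m L) : ∀ k ≥ L, rademacher m k x ^ digit m n k = 1 :=
    fun k hk => by rw [digit_eq_zero (hL.trans_le (M_strictMono.monotone hk)), pow_zero]
  rcases le_total n K with hnK | hKn
  · exact (Finset.eventually_constant_prod (hone (lt_M n)) hnK).symm
  · exact Finset.eventually_constant_prod (hone h) hKn

theorem psi_add (c j : ℕ) {i : ℕ} (hi : i < M m j) (x : G m) :
    psi m (c * M m j + i) x = psi m (c * M m j) x * psi m i x := by
  have hK := lt_M (m := m) (c * M m j + i)
  rw [psi_eq_prod hK, psi_eq_prod ((Nat.le_add_right _ _).trans_lt hK),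
    psi_eq_prod ((Nat.le_add_left i _).trans_lt hK), ← Finset.prod_mul_distrib]
  refine Finset.prod_congr rfl fun l _ => ?_
  rw [← pow_add]
  rcases lt_or_ge l j with h | h
  · rw [digit_mul_M_add_of_lt h, digit_mul_M_of_lt h, zero_add]
  · rw [digit_mul_M_add_of_le h c hi, digit_eq_zero (hi.trans_le (M_strictMono.monotone h)),
      add_zero]

theorem psi_mul_M {a k : ℕ} (ha : a < m k) (x : G m) :
    psi m (a * M m k) x = rademacher m k x ^ a := by
  have hlt : a * M m k < M m (k + 1) := Nat.mul_lt_mul_of_pos_right ha (M_pos k)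
  rw [psi_eq_prod hlt, Finset.prod_range_succ, Finset.prod_eq_one, one_mul, digit_mul_M_self ha]
  exact fun l hl => by rw [digit_mul_M_of_lt (Finset.mem_range.1 hl), pow_zero]

theorem dependsOn_psi {i n : ℕ} (hi : i < M m n) : DependsOn (psi m i) (Set.Iio n) := by
  intro x y h
  rw [psi_eq_prod hi, psi_eq_prod hi]
  refine Finset.prod_congr rfl fun k hk => ?_
  rw [rademacher, rademacher, h k (Finset.mem_range.1 hk)]

end Characters

section DirichletKernel

/-- The Dirichlet kernel `D_n = ∑_{i < n} ψ_i`, for which `S_n g` is the convolution `g * D_n`. -/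
noncomputable def dirichletKernel (m : ℕ → ℕ) (n : ℕ) (x : G m) : ℂ :=
  ∑ i ∈ Finset.range n, psi m i x

theorem mem_interval_succ {n : ℕ} {x y : G m} :
    y ∈ interval m (n + 1) x ↔ y ∈ interval m n x ∧ y n = x n :=
  Nat.forall_lt_succ_right

theorem interval_anti (x : G m) : Antitone fun n => interval m n x :=
  fun _ _ h _ hy i hi => hy i (hi.trans_le h)

variable [∀ k, (m k).AtLeastTwo]

theorem dirichletKernel_mul_M_add (c j : ℕ) {n : ℕ} (hn : n ≤ M m j) (x : G m) :
    dirichletKernel m (c * M m j + n) x =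
      dirichletKernel m (c * M m j) x + psi m (c * M m j) x * dirichletKernel m n x := by
  simp only [dirichletKernel, Finset.sum_range_add, Finset.mul_sum]
  congr 1
  exact Finset.sum_congr rfl fun i hi => psi_add c j ((Finset.mem_range.1 hi).trans_le hn) x

theorem dirichletKernel_mul_M (c j : ℕ) (x : G m) :
    dirichletKernel m (c * M m j) x =
      (∑ a ∈ Finset.range c, psi m (a * M m j) x) * dirichletKernel m (M m j) x := by
  induction c with
  | zero => simp [dirichletKernel]
  | succ c ih =>
    rw [Nat.succ_mul, dirichletKernel_mul_M_add c j le_rfl, ih, Finset.sum_range_succ, add_mul]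

theorem dirichletKernel_M (n : ℕ) (x : G m) :
    dirichletKernel m (M m n) x = (interval m n 0).indicator (fun _ => (M m n : ℂ)) x := by
  induction n with
  | zero => simp [M, dirichletKernel, psi_zero, interval]
  | succ n ih =>
    rw [M_succ, dirichletKernel_mul_M, ih, Finset.sum_congr rfl fun a ha =>
      psi_mul_M (Finset.mem_range.1 ha) x, sum_rademacher_pow]
    by_cases h0 : x n = 0 <;> by_cases hI : x ∈ interval m n 0 <;>
      simp [mem_interval_succ, h0, hI]

theorem norm_dirichletKernel_mul_M_add (c j : ℕ) {n : ℕ} (hn : n ≤ M m j) {x : G m}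
    (hx : x ∉ interval m j 0) :
    ‖dirichletKernel m (c * M m j + n) x‖ = ‖dirichletKernel m n x‖ := by
  rw [dirichletKernel_mul_M_add c j hn, dirichletKernel_mul_M, dirichletKernel_M,
    Set.indicator_of_notMem hx, mul_zero, zero_add, norm_mul, norm_psi, one_mul]

theorem dependsOn_dirichletKernel {k n : ℕ} (hk : k ≤ M m n) :
    DependsOn (dirichletKernel m k) (Set.Iio n) := fun _ _ h =>
  Finset.sum_congr rfl fun _ hi => dependsOn_psi ((Finset.mem_range.1 hi).trans_le hk) h

end DirichletKernel

section Measure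

theorem measurableSet_interval (m : ℕ → ℕ) (n : ℕ) (x : G m) : MeasurableSet (interval m n x) :=
  sigma_le m n _ (MeasurableSpace.measurableSet_generateFrom ⟨x, rfl⟩)

theorem sigma_le_piFinset (m : ℕ → ℕ) (n : ℕ) :
    sigma m n ≤ Filtration.piFinset (X := fun k => ZMod (m k)) (Finset.range n) := by
  refine MeasurableSpace.generateFrom_le ?_
  rintro _ ⟨x, rfl⟩
  refine ⟨{(Finset.range n).restrict x}, MeasurableSet.singleton _, ?_⟩
  ext y
  simp [interval, funext_iff]

theorem dependsOn_of_stronglyMeasurable {Z : Type*} [TopologicalSpace Z]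
    [TopologicalSpace.PseudoMetrizableSpace Z] [T1Space Z] {n : ℕ} {g : G m → Z}
    (hg : StronglyMeasurable[sigma m n] g) : DependsOn g (Set.Iio n) := by
  rw [← Finset.coe_range]
  exact (hg.mono (sigma_le_piFinset m n)).dependsOn_of_piFinset

variable [∀ k, NeZero (m k)]

instance isProbabilityMeasure_uniformOn_zmod (k : ℕ) :
    IsProbabilityMeasure (ProbabilityTheory.uniformOn (Set.univ : Set (ZMod (m k)))) :=
  ProbabilityTheory.isProbabilityMeasure_uniformOn Set.finite_univ Set.univ_nonempty

instance isProbabilityMeasure_μ : IsProbabilityMeasure (μ m) := by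
  unfold μ
  infer_instance

theorem uniformOn_singleton (k : ℕ) (z : ZMod (m k)) :
    ProbabilityTheory.uniformOn Set.univ {z} = (m k : ℝ≥0∞)⁻¹ := by
  rw [ProbabilityTheory.uniformOn_univ,
    Measure.count_singleton' MeasurableSpace.measurableSet_top, ZMod.card, one_div]

theorem measure_interval (n : ℕ) (x : G m) : μ m (interval m n x) = (M m n : ℝ≥0∞)⁻¹ := by
  have hpi : interval m n x = Set.pi (Finset.range n : Finset ℕ) (fun i => {x i}) := by
    ext y; simp [interval, Set.mem_pi]
  rw [hpi, μ, Measure.infinitePi_pi _ fun i _ => MeasurableSpace.measurableSet_top]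
  simp only [uniformOn_singleton, M_eq_prod, Nat.cast_prod]
  exact (ENNReal.prod_inv_distrib fun _ _ _ _ _ => Or.inr (ENNReal.natCast_ne_top _)).symm

theorem measureReal_interval (n : ℕ) (x : G m) : (μ m).real (interval m n x) = (M m n : ℝ)⁻¹ := by
  simp [Measure.real, measure_interval]

end Measure

section Coefficients

variable {g h : G m → ℂ}

theorem coeffFun_const_mul (c : ℂ) (g : G m → ℂ) (i : ℕ) :
    coeffFun m (fun x => c * g x) i = c * coeffFun m g i := by
  simp only [coeffFun, mul_assoc]
  exact integral_const_mul _ _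

theorem coeffFun_congr_ae (hgh : g =ᵐ[μ m] h) (i : ℕ) : coeffFun m g i = coeffFun m h i :=
  integral_congr_ae (hgh.mono fun x hx => by simp only [hx])

theorem partialSumFun_congr_ae (hgh : g =ᵐ[μ m] h) (n : ℕ) :
    partialSumFun m n g = partialSumFun m n h := by
  funext x
  simp only [partialSumFun, coeffFun_congr_ae hgh]

variable [∀ k, NeZero (m k)]

theorem integrable_psi (n : ℕ) : Integrable (psi m n) (μ m) :=
  Integrable.of_bound (measurable_psi m n).aestronglyMeasurable 1
    (ae_of_all _ fun x => (norm_psi n x).le)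

theorem integrable_mul_conj_psi (hg : Integrable g (μ m)) (n : ℕ) :
    Integrable (fun x => g x * (starRingEnd ℂ) (psi m n x)) (μ m) :=
  hg.mul_bdd (c := 1)
    (Complex.continuous_conj.measurable.comp (measurable_psi m n)).aestronglyMeasurable
    (ae_of_all _ fun x => by simp [norm_psi])

theorem integrable_partialSumFun (n : ℕ) (g : G m → ℂ) : Integrable (partialSumFun m n g) (μ m) :=
  integrable_finsetSum _ fun i _ => (integrable_psi i).const_mul _

theorem coeffFun_sub (hg : Integrable g (μ m)) (hh : Integrable h (μ m)) (i : ℕ) :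
    coeffFun m (g - h) i = coeffFun m g i - coeffFun m h i := by
  simp only [coeffFun, Pi.sub_apply, sub_mul]
  exact integral_sub (integrable_mul_conj_psi hg i) (integrable_mul_conj_psi hh i)

theorem coeffFun_sum {s : Finset ℕ} {g : ℕ → G m → ℂ} (hg : ∀ j ∈ s, Integrable (g j) (μ m))
    (i : ℕ) : coeffFun m (fun x => ∑ j ∈ s, g j x) i = ∑ j ∈ s, coeffFun m (g j) i := by
  simp only [coeffFun, Finset.sum_mul]
  exact integral_finsetSum _ fun j hj => integrable_mul_conj_psi (hg j hj) i

theorem partialSumFun_sub (hg : Integrable g (μ m)) (hh : Integrable h (μ m)) (n : ℕ) :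
    partialSumFun m n (g - h) = partialSumFun m n g - partialSumFun m n h := by
  funext x
  simp only [partialSumFun, coeffFun_sub hg hh, sub_mul, Finset.sum_sub_distrib, Pi.sub_apply]

theorem partialSumFun_eq_integral (hg : Integrable g (μ m)) (n : ℕ) (x : G m) :
    partialSumFun m n g x = ∫ y, g y * dirichletKernel m n (x - y) ∂μ m := by
  simp only [partialSumFun, coeffFun, ← integral_mul_const]
  rw [← integral_finsetSum _ fun i _ => (integrable_mul_conj_psi hg i).mul_const _]
  simp only [dirichletKernel, psi_sub, Finset.mul_sum]
  congr! 3 with y i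
  ring

end Coefficients

section Projection

variable [∀ k, (m k).AtLeastTwo] {g : G m → ℂ} {n : ℕ}

theorem partialSumFun_M (hg : Integrable g (μ m)) (n : ℕ) (x : G m) :
    partialSumFun m (M m n) g x = M m n * ∫ y in interval m n x, g y ∂μ m := by
  have hmem (y : G m) : x - y ∈ interval m n 0 ↔ y ∈ interval m n x := by
    simp [interval, sub_eq_zero, eq_comm]
  have hkernel (y : G m) : g y * dirichletKernel m (M m n) (x - y) =
      (interval m n x).indicator (fun y => M m n * g y) y := by
    classical
    simp [dirichletKernel_M, Set.indicator_apply, hmem, mul_comm]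
  simp only [partialSumFun_eq_integral hg, hkernel]
  rw [integral_indicator (measurableSet_interval m n x), integral_const_mul]

theorem partialSumFun_M_of_dependsOn (hg : Integrable g (μ m)) (h : DependsOn g (Set.Iio n)) :
    partialSumFun m (M m n) g = g := by
  funext x
  have hM : (M m n : ℂ) ≠ 0 := NeZero.ne _
  rw [partialSumFun_M hg, setIntegral_congr_fun (g := fun _ => g x) (measurableSet_interval m n x)
    fun y hy => h fun i hi => hy i hi, setIntegral_const, measureReal_interval, Complex.real_smul,
    Complex.ofReal_inv, Complex.ofReal_natCast, mul_inv_cancel_left₀ hM]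

theorem condExp_filtration (hg : Integrable g (μ m)) (n : ℕ) :
    (μ m)[g | filtration m n] = partialSumFun m (M m n) g := by
  have hdep : DependsOn ((μ m)[g | filtration m n]) (Set.Iio n) :=
    dependsOn_of_stronglyMeasurable stronglyMeasurable_condExp
  rw [← partialSumFun_M_of_dependsOn integrable_condExp hdep]
  funext x
  rw [partialSumFun_M integrable_condExp, partialSumFun_M hg,
    setIntegral_condExp ((filtration m).le n) hg
      (MeasurableSpace.measurableSet_generateFrom ⟨x, rfl⟩)]

theorem eLpNorm_partialSumFun_M_le (hg : Integrable g (μ m)) (n : ℕ) :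
    eLpNorm (partialSumFun m (M m n) g) 1 (μ m) ≤ eLpNorm g 1 (μ m) := by
  rw [← condExp_filtration hg]
  exact eLpNorm_condExp_le_eLpNorm _ le_rfl

end Projection

section Orthonormality

theorem coeffFun_psi_self [∀ k, NeZero (m k)] (i : ℕ) : coeffFun m (psi m i) i = 1 := by
  simp [coeffFun, psi_mul_conj]

variable [∀ k, (m k).AtLeastTwo] {g : G m → ℂ} {n : ℕ}

theorem sum_norm_sq_coeffFun (hg : Integrable g (μ m)) (h : DependsOn g (Set.Iio n)) :
    ∑ k ∈ Finset.range (M m n), ‖coeffFun m g k‖ ^ 2 = ∫ x, ‖g x‖ ^ 2 ∂μ m := by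
  have hself := partialSumFun_M_of_dependsOn hg h
  apply Complex.ofReal_injective
  calc ((∑ k ∈ Finset.range (M m n), ‖coeffFun m g k‖ ^ 2 : ℝ) : ℂ)
      = ∑ k ∈ Finset.range (M m n), coeffFun m g k * (starRingEnd ℂ) (coeffFun m g k) := by
        simp only [Complex.mul_conj', Complex.ofReal_sum, Complex.ofReal_pow]
    _ = ∫ x, ∑ k ∈ Finset.range (M m n),
          g x * (starRingEnd ℂ) (psi m k x) * (starRingEnd ℂ) (coeffFun m g k) ∂μ m := by
        rw [integral_finsetSum _ fun k _ => (integrable_mul_conj_psi hg k).mul_const _]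
        simp only [integral_mul_const, coeffFun]
    _ = ∫ x, g x * (starRingEnd ℂ) (partialSumFun m (M m n) g x) ∂μ m := by
        simp only [partialSumFun, map_sum, map_mul, Finset.mul_sum]
        congr! 3 with x k
        ring
    _ = ((∫ x, ‖g x‖ ^ 2 ∂μ m : ℝ) : ℂ) := by
        rw [hself, ← integral_complex_ofReal]
        simp only [Complex.mul_conj', Complex.ofReal_pow]

theorem coeffFun_psi_of_ne {i j : ℕ} (hij : i ≠ j) : coeffFun m (psi m j) i = 0 := by
  let n := max i j
  have hi : i < M m n := (le_max_left i j).trans_lt (lt_M n)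
  have hj : j < M m n := (le_max_right i j).trans_lt (lt_M n)
  have hsum := sum_norm_sq_coeffFun (integrable_psi j) (dependsOn_psi hj)
  rw [← Finset.add_sum_erase _ _ (Finset.mem_range.2 hj), coeffFun_psi_self] at hsum
  have herase : ∑ k ∈ (Finset.range (M m n)).erase j, ‖coeffFun m (psi m j) k‖ ^ 2 = 0 := by
    simpa [norm_psi] using hsum
  have hzero := (Finset.sum_eq_zero_iff_of_nonneg fun _ _ => sq_nonneg _).1 herase i
    (Finset.mem_erase.2 ⟨hij, Finset.mem_range.2 hi⟩)
  exact norm_eq_zero.1 (pow_eq_zero_iff two_ne_zero |>.1 hzero)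

theorem coeffFun_psi (i j : ℕ) : coeffFun m (psi m j) i = if i = j then 1 else 0 := by
  split_ifs with hij
  · rw [hij, coeffFun_psi_self]
  · exact coeffFun_psi_of_ne hij

theorem coeffFun_sum_psi (s : Finset ℕ) (c : ℕ → ℂ) (i : ℕ) :
    coeffFun m (fun x => ∑ j ∈ s, c j * psi m j x) i = if i ∈ s then c i else 0 := by
  rw [coeffFun_sum fun k _ => (integrable_psi k).const_mul _]
  simp only [coeffFun_const_mul, coeffFun_psi, mul_ite, mul_one, mul_zero, Finset.sum_ite_eq]

theorem partialSumFun_sum_psi (k n : ℕ) (c : ℕ → ℂ) :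
    partialSumFun m k (fun x => ∑ j ∈ Finset.range n, c j * psi m j x) =
      fun x => ∑ j ∈ Finset.range (min k n), c j * psi m j x := by
  funext x
  simp only [partialSumFun, coeffFun_sum_psi, ite_mul, zero_mul]
  rw [← Finset.sum_filter]
  congr 1
  ext i
  simp

theorem coeffFun_partialSumFun {n i : ℕ} (hi : i < n) (g : G m → ℂ) :
    coeffFun m (partialSumFun m n g) i = coeffFun m g i :=
  (coeffFun_sum_psi _ _ i).trans (if_pos (Finset.mem_range.2 hi))

theorem partialSumFun_partialSumFun (k n : ℕ) (g : G m → ℂ) :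
    partialSumFun m k (partialSumFun m n g) = partialSumFun m (min k n) g :=
  partialSumFun_sum_psi k n _

theorem partialSumFun_dirichletKernel (k n : ℕ) :
    partialSumFun m k (dirichletKernel m n) = dirichletKernel m (min k n) := by
  have h := partialSumFun_sum_psi (m := m) k n 1
  simp only [Pi.one_apply, one_mul] at h
  exact h

end Orthonormality

section Martingales

variable [∀ k, (m k).AtLeastTwo] {f : ℕ → G m → ℂ}

theorem martingale_iff_partialSumFun_eq :
    Martingale f (filtration m) (μ m) ↔ (∀ n, Integrable (f n) (μ m)) ∧
      ∀ i j, partialSumFun m (M m i) (f j) = f (min i j) := by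
  constructor
  · intro hf
    have hself (i : ℕ) : partialSumFun m (M m i) (f i) = f i :=
      partialSumFun_M_of_dependsOn (hf.integrable i) (dependsOn_of_stronglyMeasurable (hf.1 i))
    refine ⟨hf.integrable, fun i j => ?_⟩
    rcases le_total i j with hij | hji
    · have hae : partialSumFun m (M m i) (f j) =ᵐ[μ m] f i := by
        rw [← condExp_filtration (hf.integrable j)]
        exact hf.2 i j hij
      rw [min_eq_left hij, ← hself i, ← partialSumFun_congr_ae hae, partialSumFun_partialSumFun,
        min_self]
    · rw [min_eq_right hji, ← hself j, partialSumFun_partialSumFun,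
        min_eq_right (M_strictMono.monotone hji)]
  · rintro ⟨hint, hf⟩
    have hcond (i j : ℕ) : (μ m)[f j | filtration m i] = f (min i j) := by
      rw [condExp_filtration (hint j), hf]
    refine ⟨fun i => ?_, fun i j hij => by rw [hcond, min_eq_left hij]⟩
    rw [← min_self i, ← hcond, min_self]
    exact stronglyMeasurable_condExp

variable (hf : Martingale f (filtration m) (μ m))
include hf

theorem coeff_eq_coeffFun {i k : ℕ} (hi : i < M m k) : coeff m f i = coeffFun m (f k) i := by
  refine Tendsto.limUnder_eq (tendsto_const_nhds.congr' ?_)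
  filter_upwards [eventually_ge_atTop k] with l hl
  rw [← min_eq_left hl, ← (martingale_iff_partialSumFun_eq.1 hf).2, coeffFun_partialSumFun hi]

theorem partialSum_eq_partialSumFun {n k : ℕ} (hn : n ≤ M m k) :
    partialSum m n f = partialSumFun m n (f k) := by
  funext x
  refine Finset.sum_congr rfl fun i hi => ?_
  rw [coeff_eq_coeffFun hf ((Finset.mem_range.1 hi).trans_le hn)]

theorem toMartingale_partialSum (n k : ℕ) :
    toMartingale m (partialSum m (M m n) f) k = f (min k n) := by
  have hS := (martingale_iff_partialSumFun_eq.1 hf).2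
  rw [toMartingale, partialSum_eq_partialSumFun hf le_rfl, hS, min_self, hS]

theorem modulus_eq_hardyNorm (n : ℕ) :
    modulus m n f = hardyNorm m fun k => f k - f (min k n) := by
  simp only [modulus, toMartingale_partialSum hf]
  rfl

end Martingales

section Hardy

variable {f : ℕ → G m → ℂ}

theorem enorm_le_maximal (f : ℕ → G m → ℂ) (n : ℕ) (x : G m) : ‖f n x‖ₑ ≤ maximal m f x :=
  le_iSup (fun n => ‖f n x‖ₑ) n

theorem eLpNorm_le_hardyNorm (f : ℕ → G m → ℂ) (n : ℕ) :
    eLpNorm (f n) 1 (μ m) ≤ hardyNorm m f := by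
  rw [eLpNorm_one_eq_lintegral_enorm]
  exact lintegral_mono fun x => enorm_le_maximal f n x

theorem enorm_sub_le_maximal {n k : ℕ} (hnk : n ≤ k) (x : G m) :
    ‖f k x - f n x‖ₑ ≤ maximal m (fun k => f k - f (min k n)) x := by
  simpa [min_eq_right hnk] using enorm_le_maximal (fun k => f k - f (min k n)) k x

theorem measurable_maximal (hf : StronglyAdapted (filtration m) f) : Measurable (maximal m f) :=
  Measurable.iSup fun n => ((hf n).mono ((filtration m).le n)).measurable.enorm

theorem ae_tendsto_limit [∀ k, NeZero (m k)] (hf : MemHardy m f) :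
    ∀ᵐ x ∂μ m, Tendsto (fun n => f n x) atTop (𝓝 (limit m f x)) := by
  have hbdd (n : ℕ) : eLpNorm (f n) 1 (μ m) ≤ (hardyNorm m f).toNNReal := by
    rw [ENNReal.coe_toNNReal hf.2.ne]
    exact eLpNorm_le_hardyNorm f n
  exact (martingale_exists_ae_tendsto_of_bdd hf.1 hbdd).mono fun x hx => tendsto_nhds_limUnder hx

variable [∀ k, (m k).AtLeastTwo]

theorem represents_limit (hf : MemHardy m f) : Represents m (limit m f) f := by
  have hlim := ae_tendsto_limit hf
  have hmax := measurable_maximal hf.1.1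
  have hbound : Integrable (fun x => (maximal m f x).toReal) (μ m) :=
    integrable_toReal_of_lintegral_ne_top hmax.aemeasurable hf.2.ne
  have hle (n : ℕ) : ∀ᵐ x ∂μ m, ‖f n x‖ ≤ (maximal m f x).toReal := by
    filter_upwards [ae_lt_top hmax hf.2.ne] with x hx
    rw [← toReal_enorm]
    exact ENNReal.toReal_mono hx.ne (enorm_le_maximal f n x)
  have hint : Integrable (limit m f) (μ m) :=
    ⟨aestronglyMeasurable_of_tendsto_ae atTop (fun n => (hf.1.integrable n).1) hlim,
      hasFiniteIntegral_of_dominated_convergence hbound.2 hle hlim⟩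
  exact ⟨memLp_one_iff_integrable.2 hint, hlim,
    martingale_ae_eq_condExp_of_dominated hf.1 hbound hle hlim⟩

theorem modulus_lt_top (hf : MemHardy m f) (n : ℕ) : modulus m n f < ∞ := by
  rw [modulus_eq_hardyNorm hf.1]
  calc hardyNorm m (fun k => f k - f (min k n))
      ≤ ∫⁻ x, (maximal m f x + maximal m f x) ∂μ m :=
        lintegral_mono fun x => iSup_le fun k => enorm_sub_le.trans
          (add_le_add (enorm_le_maximal f _ x) (enorm_le_maximal f _ x))
    _ = hardyNorm m f + hardyNorm m f := lintegral_add_left (measurable_maximal hf.1.1) _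
    _ < ∞ := ENNReal.add_lt_top.2 ⟨hf.2, hf.2⟩

variable (hf : Martingale f (filtration m) (μ m))
include hf

theorem eLpNorm_sub_le_modulus {n k : ℕ} (hnk : n ≤ k) :
    eLpNorm (f k - f n) 1 (μ m) ≤ modulus m n f := by
  rw [modulus_eq_hardyNorm hf]
  simpa [min_eq_right hnk] using eLpNorm_le_hardyNorm (fun k => f k - f (min k n)) k

theorem eLpNorm_limit_sub_le_modulus {F : G m → ℂ}
    (hF : ∀ᵐ x ∂μ m, Tendsto (fun n => f n x) atTop (𝓝 (F x))) (n : ℕ) :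
    eLpNorm (F - f n) 1 (μ m) ≤ modulus m n f := by
  rw [modulus_eq_hardyNorm hf, eLpNorm_one_eq_lintegral_enorm]
  refine lintegral_mono_ae ?_
  filter_upwards [hF] with x hx
  refine le_of_tendsto (hx.sub_const (f n x)).enorm ?_
  filter_upwards [eventually_ge_atTop n] with k hk
  exact enorm_sub_le_maximal hk x

end Hardy

section UpperBound

theorem partialSumFun_zero (g : G m → ℂ) : partialSumFun m 0 g = 0 :=
  funext fun _ => Finset.sum_range_zero _

theorem one_div_isBigO_one_div_sum [∀ k, NeZero (m k)] {B : ℕ} (hB : ∀ k, m k ≤ B) :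
    (fun n : ℕ => 1 / (n : ℝ)) =O[atTop]
      fun n : ℕ => 1 / (∑ j ∈ Finset.range (n + 1), m j : ℝ) := by
  refine IsBigO.of_bound (2 * B) ((eventually_ge_atTop 1).mono fun n hn => ?_)
  have hcard : ∑ j ∈ Finset.range (n + 1), m j ≤ (n + 1) * B := by
    simpa using Finset.sum_le_card_nsmul (Finset.range (n + 1)) m B fun k _ => hB k
  have hsum : (∑ j ∈ Finset.range (n + 1), m j : ℝ) ≤ 2 * B * n := by
    exact_mod_cast hcard.trans (by nlinarith)
  have hpos : (0 : ℝ) < ∑ j ∈ Finset.range (n + 1), (m j : ℝ) :=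
    Finset.sum_pos (fun j _ => Nat.cast_pos.2 (NeZero.pos (m j))) Finset.nonempty_range_add_one
  have hn' : (0 : ℝ) < n := Nat.cast_pos.2 hn
  rw [Real.norm_of_nonneg (by positivity), Real.norm_of_nonneg (by positivity), mul_one_div,
    div_le_div_iff₀ hn' hpos, one_mul]
  exact hsum

theorem eLpNorm_mul_conj_psi [∀ k, NeZero (m k)] (g : G m → ℂ) (k : ℕ) :
    eLpNorm (fun y => g y * (starRingEnd ℂ) (psi m k y)) 1 (μ m) = eLpNorm g 1 (μ m) :=
  eLpNorm_congr_norm_ae (ae_of_all _ fun y => by simp [norm_psi])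

variable [∀ k, (m k).AtLeastTwo] {g : G m → ℂ} {n : ℕ}

theorem partialSumFun_mul_M_add (g : G m → ℂ) (c : ℕ) {j : ℕ} (hn : n ≤ M m j) (x : G m) :
    partialSumFun m (c * M m j + n) g x = partialSumFun m (c * M m j) g x +
      psi m (c * M m j) x *
        partialSumFun m n (fun y => g y * (starRingEnd ℂ) (psi m (c * M m j) y)) x := by
  simp only [partialSumFun, Finset.sum_range_add, Finset.mul_sum]
  congr 1
  refine Finset.sum_congr rfl fun i hi => ?_
  have hadd := psi_add c j ((Finset.mem_range.1 hi).trans_le hn)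
  have hcoeff : coeffFun m g (c * M m j + i) =
      coeffFun m (fun y => g y * (starRingEnd ℂ) (psi m (c * M m j) y)) i := by
    simp only [coeffFun, hadd, map_mul, mul_assoc]
  rw [hcoeff, hadd, mul_left_comm]

theorem eLpNorm_partialSumFun_mul_M_add_le (g : G m → ℂ) (c : ℕ) {j : ℕ} (hn : n ≤ M m j) :
    eLpNorm (partialSumFun m (c * M m j + n) g) 1 (μ m) ≤
      eLpNorm (partialSumFun m (c * M m j) g) 1 (μ m) + eLpNorm (partialSumFun m n
        fun y => g y * (starRingEnd ℂ) (psi m (c * M m j) y)) 1 (μ m) := by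
  have hshift := funext (partialSumFun_mul_M_add g c hn)
  rw [hshift]
  refine (eLpNorm_add_le (integrable_partialSumFun _ _).1
    ((integrable_psi _).1.mul (integrable_partialSumFun _ _).1) le_rfl).trans
    (add_le_add_right (eLpNorm_congr_norm_ae (ae_of_all _ fun x => ?_)).le _)
  rw [Pi.mul_apply, norm_mul, norm_psi, one_mul]

theorem eLpNorm_partialSumFun_mul_M_le (hg : Integrable g (μ m)) (c j : ℕ) :
    eLpNorm (partialSumFun m (c * M m j) g) 1 (μ m) ≤ c * eLpNorm g 1 (μ m) := by
  induction c with
  | zero => simp [partialSumFun_zero]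
  | succ c ih =>
    rw [Nat.succ_mul, Nat.cast_succ, add_mul, one_mul]
    refine (eLpNorm_partialSumFun_mul_M_add_le g c le_rfl).trans (add_le_add ih ?_)
    rw [← eLpNorm_mul_conj_psi g (c * M m j)]
    exact eLpNorm_partialSumFun_M_le (integrable_mul_conj_psi hg _) j

theorem eLpNorm_partialSumFun_le (hg : Integrable g (μ m)) {N : ℕ} (hn : n < M m N) :
    eLpNorm (partialSumFun m n g) 1 (μ m) ≤
      (∑ j ∈ Finset.range N, digit m n j : ℕ) * eLpNorm g 1 (μ m) := by
  induction N generalizing n g with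
  | zero =>
    obtain rfl : n = 0 := by simpa [M] using hn
    simp [partialSumFun_zero]
  | succ N ih =>
    obtain ⟨c, r, hr, rfl⟩ : ∃ c r, r < M m N ∧ n = c * M m N + r :=
      ⟨n / M m N, n % M m N, Nat.mod_lt _ (M_pos N), (Nat.div_add_mod' n _).symm⟩
    have hc : c < m N := lt_of_mul_lt_mul_right ((Nat.le_add_right _ r).trans_lt hn) (Nat.zero_le _)
    have hdigits : ∑ j ∈ Finset.range (N + 1), digit m (c * M m N + r) j =
        c + ∑ j ∈ Finset.range N, digit m r j := by
      rw [Finset.sum_range_succ, add_comm, digit_mul_M_add_of_le le_rfl c hr, digit_mul_M_self hc,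
        Finset.sum_congr rfl fun j hj => digit_mul_M_add_of_lt (Finset.mem_range.1 hj) c r]
    rw [hdigits, Nat.cast_add, add_mul]
    refine (eLpNorm_partialSumFun_mul_M_add_le g c hr.le).trans
      (add_le_add (eLpNorm_partialSumFun_mul_M_le hg c N) ?_)
    rw [← eLpNorm_mul_conj_psi g (c * M m N)]
    exact ih (integrable_mul_conj_psi hg _) hr

theorem eLpNorm_partialSum_sub_le {f : ℕ → G m → ℂ} (hf : Martingale f (filtration m) (μ m))
    {F : G m → ℂ} (hF : ∀ᵐ x ∂μ m, Tendsto (fun n => f n x) atTop (𝓝 (F x)))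
    {N k : ℕ} (hNk : M m N ≤ k) (hkN : k < M m (N + 1)) :
    eLpNorm (partialSum m k f - F) 1 (μ m) ≤
      (∑ j ∈ Finset.range (N + 1), m j : ℕ) * modulus m N f := by
  have hint := hf.integrable
  have hFmeas : AEStronglyMeasurable F (μ m) :=
    aestronglyMeasurable_of_tendsto_ae atTop (fun n => (hint n).1) hF
  have hfix : partialSumFun m k (f N) = f N := by
    rw [← min_self N, ← (martingale_iff_partialSumFun_eq.1 hf).2, partialSumFun_partialSumFun,
      min_eq_right hNk]
  have hsplit : partialSum m k f - F = partialSumFun m k (f (N + 1) - f N) - (F - f N) := by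
    rw [partialSum_eq_partialSumFun hf hkN.le, partialSumFun_sub (hint _) (hint _), hfix,
      sub_sub_sub_cancel_right]
  have hdigits : ∑ j ∈ Finset.range (N + 1), digit m k j + 1 ≤ ∑ j ∈ Finset.range (N + 1), m j :=
    Finset.sum_lt_sum_of_nonempty Finset.nonempty_range_add_one fun j _ => digit_lt k j
  calc eLpNorm (partialSum m k f - F) 1 (μ m)
      ≤ eLpNorm (partialSumFun m k (f (N + 1) - f N)) 1 (μ m) + eLpNorm (F - f N) 1 (μ m) := by
        rw [hsplit]
        exact eLpNorm_sub_le (integrable_partialSumFun _ _).1 (hFmeas.sub (hint N).1) le_rfl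
    _ ≤ (∑ j ∈ Finset.range (N + 1), digit m k j : ℕ) * modulus m N f + modulus m N f := by
        refine add_le_add ((eLpNorm_partialSumFun_le ((hint _).sub (hint _)) hkN).trans ?_)
          (eLpNorm_limit_sub_le_modulus hf hF N)
        gcongr
        exact eLpNorm_sub_le_modulus hf N.le_succ
    _ = (∑ j ∈ Finset.range (N + 1), digit m k j + 1 : ℕ) * modulus m N f := by
        rw [Nat.cast_succ, add_mul, one_mul]
    _ ≤ (∑ j ∈ Finset.range (N + 1), m j : ℕ) * modulus m N f := by gcongr

theorem tendsto_partialSum_of_modulus_isLittleO {f : ℕ → G m → ℂ} (hf : MemHardy m f)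
    (ho : (fun n => (modulus m n f).toReal) =o[atTop]
      fun n : ℕ => 1 / (∑ j ∈ Finset.range (n + 1), m j : ℝ)) :
    Tendsto (fun k => eLpNorm (partialSum m k f - limit m f) 1 (μ m)) atTop (𝓝 0) := by
  have hmul : Tendsto (fun n => (∑ j ∈ Finset.range (n + 1), m j : ℕ) * modulus m n f)
      atTop (𝓝 0) := by
    rw [← ENNReal.tendsto_toReal_iff (fun n => ENNReal.mul_ne_top (ENNReal.natCast_ne_top _)
      (modulus_lt_top hf n).ne) ENNReal.zero_ne_top]
    simp only [ENNReal.toReal_mul, ENNReal.toReal_natCast, ENNReal.toReal_zero]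
    simpa [mul_comm] using ho.tendsto_div_nhds_zero
  refine ENNReal.tendsto_atTop_zero.2 fun ε hε => ?_
  obtain ⟨N₀, hN₀⟩ := ENNReal.tendsto_atTop_zero.1 hmul ε hε
  refine ⟨M m N₀, fun k hk => ?_⟩
  obtain ⟨N, hN, hN'⟩ := M_strictMono.exists_between_of_tendsto_atTop
    (M_strictMono (m := m)).tendsto_atTop (Nat.succ_lt_succ ((M_pos N₀).trans_le hk))
  have hN₀N : N₀ < N + 1 := M_strictMono.lt_iff_lt.1 (hk.trans_lt hN')
  exact (eLpNorm_partialSum_sub_le hf.1 (ae_tendsto_limit hf) (Nat.lt_succ_iff.1 hN) hN').trans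
    (hN₀ N (Nat.lt_succ_iff.1 hN₀N))

end UpperBound

section DirichletLowerBound

/-- The index `∑_{i < K} (m_{2i} - 1) M_{2i}`, whose digits alternate between maximal and zero; the
`L_1` norm of its Dirichlet kernel grows linearly in `K`. -/
def alternatingIndex (m : ℕ → ℕ) : ℕ → ℕ
  | 0 => 0
  | K + 1 => (m (2 * K) - 1) * M m (2 * K) + alternatingIndex m K

theorem pred_mul_M_add_M [∀ k, NeZero (m k)] (k : ℕ) : (m k - 1) * M m k + M m k = M m (k + 1) := by
  rw [← Nat.succ_mul, Nat.succ_eq_add_one, Nat.sub_add_cancel NeZero.one_le, M_succ]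

variable [∀ k, (m k).AtLeastTwo] {n j : ℕ}

theorem dirichletKernel_of_mem_interval (hn : n ≤ M m j) {x : G m} (hx : x ∈ interval m j 0) :
    dirichletKernel m n x = n := by
  rw [dependsOn_dirichletKernel hn fun i hi => hx i hi]
  simp [dirichletKernel, psi, rademacher]

theorem le_measureReal_interval_diff (j : ℕ) :
    (2 * M m j : ℝ)⁻¹ ≤ (μ m).real (interval m j 0 \ interval m (j + 1) 0) := by
  have hpos : (0 : ℝ) < M m j := Nat.cast_pos.2 (M_pos j)
  have hle : (2 * M m j : ℝ) ≤ M m (j + 1) := by exact_mod_cast two_mul_M_le j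
  have hinv : (M m (j + 1) : ℝ)⁻¹ ≤ (2 * M m j : ℝ)⁻¹ := inv_anti₀ (by positivity) hle
  have hhalf : (M m j : ℝ)⁻¹ = 2 * (2 * M m j : ℝ)⁻¹ := by field_simp
  rw [measureReal_sdiff (interval_anti 0 j.le_succ) (measurableSet_interval m _ _),
    measureReal_interval, measureReal_interval]
  linarith

theorem inv_four_le_setLIntegral_dirichletKernel (hn : n ≤ M m j) (hn' : M m j ≤ 2 * n) :
    4⁻¹ ≤ ∫⁻ x in interval m j 0 \ interval m (j + 1) 0, ‖dirichletKernel m n x‖ₑ ∂μ m := by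
  have hpos : (0 : ℝ) < M m j := Nat.cast_pos.2 (M_pos j)
  have hhalf : (M m j / 2 : ℝ) ≤ n := by
    rw [div_le_iff₀' two_pos]
    exact_mod_cast hn'
  have hreal : (4⁻¹ : ℝ) ≤ n * (μ m).real (interval m j 0 \ interval m (j + 1) 0) :=
    calc (4⁻¹ : ℝ) = M m j / 2 * (2 * M m j : ℝ)⁻¹ := by field_simp; norm_num
      _ ≤ n * (μ m).real (interval m j 0 \ interval m (j + 1) 0) := by
        gcongr
        exact le_measureReal_interval_diff j
  rw [setLIntegral_congr_fun (g := fun _ => (n : ℝ≥0∞))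
    ((measurableSet_interval m _ _).diff (measurableSet_interval m _ _)) fun x hx => by
      rw [dirichletKernel_of_mem_interval hn hx.1, ← ofReal_norm, Complex.norm_natCast,
        ENNReal.ofReal_natCast],
    setLIntegral_const, ← ofReal_measureReal, ← ENNReal.ofReal_natCast,
    ← ENNReal.ofReal_mul n.cast_nonneg]
  simpa [ENNReal.ofReal_inv_of_pos] using ENNReal.ofReal_le_ofReal hreal

theorem alternatingIndex_lt (K : ℕ) : alternatingIndex m K < M m (2 * K) := by
  induction K with
  | zero => exact M_pos 0
  | succ K ih =>
    calc alternatingIndex m (K + 1) < (m (2 * K) - 1) * M m (2 * K) + M m (2 * K) :=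
          Nat.add_lt_add_left ih _
      _ = M m (2 * K + 1) := pred_mul_M_add_M _
      _ ≤ M m (2 * (K + 1)) := M_strictMono.monotone (Nat.le_succ _)

theorem alternatingIndex_succ_le (K : ℕ) : alternatingIndex m (K + 1) ≤ M m (2 * K + 1) := by
  rw [alternatingIndex, ← pred_mul_M_add_M]
  exact Nat.add_le_add_left (alternatingIndex_lt K).le _

theorem M_le_two_mul_alternatingIndex (K : ℕ) :
    M m (2 * K + 1) ≤ 2 * alternatingIndex m (K + 1) := by
  have hdigit : m (2 * K) ≤ 2 * (m (2 * K) - 1) := by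
    have : 2 ≤ m (2 * K) := Nat.AtLeastTwo.prop
    omega
  calc M m (2 * K + 1) ≤ 2 * (m (2 * K) - 1) * M m (2 * K) := Nat.mul_le_mul_right _ hdigit
    _ = 2 * ((m (2 * K) - 1) * M m (2 * K)) := mul_assoc _ _ _
    _ ≤ 2 * alternatingIndex m (K + 1) := Nat.mul_le_mul_left _ (Nat.le_add_right _ _)

theorem le_setLIntegral_dirichletKernel_alternatingIndex (K : ℕ) :
    (K : ℝ≥0∞) * 4⁻¹ ≤
      ∫⁻ x in (interval m (2 * K) 0)ᶜ, ‖dirichletKernel m (alternatingIndex m K) x‖ₑ ∂μ m := by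
  induction K with
  | zero => simp
  | succ K ih =>
    let D := dirichletKernel m (alternatingIndex m (K + 1))
    let shell := interval m (2 * K + 1) 0 \ interval m (2 * K + 2) 0
    have hshell : MeasurableSet shell :=
      (measurableSet_interval m _ _).diff (measurableSet_interval m _ _)
    have hdisj : Disjoint (interval m (2 * K) 0)ᶜ shell :=
      Set.disjoint_left.2 fun _ hx hx' => hx (interval_anti 0 (Nat.le_succ _) hx'.1)
    have hsub : (interval m (2 * K) 0)ᶜ ∪ shell ⊆ (interval m (2 * (K + 1)) 0)ᶜ :=
      Set.union_subset (Set.compl_subset_compl.2 (interval_anti 0 (by omega))) fun _ hx => hx.2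
    calc ((K + 1 : ℕ) : ℝ≥0∞) * 4⁻¹ = K * 4⁻¹ + 4⁻¹ := by rw [Nat.cast_succ, add_mul, one_mul]
      _ ≤ ∫⁻ x in (interval m (2 * K) 0)ᶜ, ‖D x‖ₑ ∂μ m + ∫⁻ x in shell, ‖D x‖ₑ ∂μ m := by
        refine add_le_add (ih.trans_eq ?_) (inv_four_le_setLIntegral_dirichletKernel
          (alternatingIndex_succ_le K) (M_le_two_mul_alternatingIndex K))
        refine setLIntegral_congr_fun (measurableSet_interval m _ _).compl fun x hx => ?_
        simp only [D, alternatingIndex, ← ofReal_norm,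
          norm_dirichletKernel_mul_M_add _ _ (alternatingIndex_lt K).le hx]
      _ = ∫⁻ x in (interval m (2 * K) 0)ᶜ ∪ shell, ‖D x‖ₑ ∂μ m :=
        (lintegral_union hshell hdisj).symm
      _ ≤ ∫⁻ x in (interval m (2 * (K + 1)) 0)ᶜ, ‖D x‖ₑ ∂μ m := lintegral_mono_set hsub

theorem le_eLpNorm_dirichletKernel_alternatingIndex (K : ℕ) :
    (K : ℝ≥0∞) * 4⁻¹ ≤ eLpNorm (dirichletKernel m (alternatingIndex m K)) 1 (μ m) := by
  rw [eLpNorm_one_eq_lintegral_enorm]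
  exact (le_setLIntegral_dirichletKernel_alternatingIndex K).trans (setLIntegral_le_lintegral _ _)

end DirichletLowerBound

section LevelSeries

/-- The martingale `f_n = ∑_{j < n} a_j (D_{M_{j+1}} - D_{M_j})`, whose `i`-th Vilenkin–Fourier
coefficient is `a_j` for all `M_j ≤ i < M_{j+1}`. -/
noncomputable def levelSeries (m : ℕ → ℕ) (a : ℕ → ℂ) (n : ℕ) (x : G m) : ℂ :=
  ∑ j ∈ Finset.range n, a j * (dirichletKernel m (M m (j + 1)) - dirichletKernel m (M m j)) x

theorem measurable_dirichletKernel (m : ℕ → ℕ) (n : ℕ) : Measurable (dirichletKernel m n) :=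
  Finset.measurable_fun_sum _ fun i _ => measurable_psi m i

theorem integrable_dirichletKernel [∀ k, NeZero (m k)] (n : ℕ) :
    Integrable (dirichletKernel m n) (μ m) :=
  integrable_finsetSum _ fun i _ => integrable_psi i

theorem enorm_levelSeries_sub_le (a : ℕ → ℂ) (n k : ℕ) (x : G m) :
    ‖levelSeries m a k x - levelSeries m a (min k n) x‖ₑ ≤ ∑' j, ‖a (n + j)‖ₑ *
      ‖(dirichletKernel m (M m (n + j + 1)) - dirichletKernel m (M m (n + j))) x‖ₑ := by
  rcases le_total k n with hkn | hnk
  · simp [min_eq_left hkn]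
  · rw [min_eq_right hnk, levelSeries, levelSeries, ← Finset.sum_Ico_eq_sub _ hnk,
      Finset.sum_Ico_eq_sum_range]
    refine (enorm_sum_le _ _).trans ?_
    simp only [enorm_mul]
    exact ENNReal.sum_le_tsum _

theorem integrable_levelSeries [∀ k, NeZero (m k)] (a : ℕ → ℂ) (n : ℕ) :
    Integrable (levelSeries m a n) (μ m) :=
  integrable_finsetSum _ fun _ _ =>
    ((integrable_dirichletKernel _).sub (integrable_dirichletKernel _)).const_mul _

variable [∀ k, (m k).AtLeastTwo] {a : ℕ → ℂ}

theorem eLpNorm_dirichletKernel_M (n : ℕ) :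
    eLpNorm (dirichletKernel m (M m n)) 1 (μ m) = 1 := by
  rw [funext (dirichletKernel_M n), eLpNorm_indicator_const (measurableSet_interval m n 0)
    one_ne_zero ENNReal.one_ne_top, measure_interval, ← ofReal_norm, Complex.norm_natCast,
    ENNReal.ofReal_natCast]
  simp [ENNReal.mul_inv_cancel, NeZero.ne]

theorem lintegral_enorm_dirichletKernel_M_sub_le (j : ℕ) :
    ∫⁻ x, ‖(dirichletKernel m (M m (j + 1)) - dirichletKernel m (M m j)) x‖ₑ ∂μ m ≤ 2 := by
  rw [← eLpNorm_one_eq_lintegral_enorm]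
  refine (eLpNorm_sub_le (integrable_dirichletKernel _).1 (integrable_dirichletKernel _).1
    le_rfl).trans_eq ?_
  rw [eLpNorm_dirichletKernel_M, eLpNorm_dirichletKernel_M, one_add_one_eq_two]

theorem partialSumFun_levelSeries (a : ℕ → ℂ) (k n : ℕ) (x : G m) :
    partialSumFun m k (levelSeries m a n) x =
      ∑ j ∈ Finset.range n, a j * (dirichletKernel m (min k (M m (j + 1))) -
        dirichletKernel m (min k (M m j))) x := by
  have hblock (j : ℕ) : Integrable
      (dirichletKernel m (M m (j + 1)) - dirichletKernel m (M m j)) (μ m) :=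
    (integrable_dirichletKernel _).sub (integrable_dirichletKernel _)
  simp only [← partialSumFun_dirichletKernel, ← partialSumFun_sub (integrable_dirichletKernel _)
    (integrable_dirichletKernel _)]
  unfold levelSeries
  simp only [partialSumFun, coeffFun_sum fun j _ => (hblock j).const_mul (a j), coeffFun_const_mul,
    Finset.sum_mul, Finset.mul_sum, mul_assoc]
  exact Finset.sum_comm

theorem partialSumFun_M_levelSeries (a : ℕ → ℂ) (i n : ℕ) :
    partialSumFun m (M m i) (levelSeries m a n) = levelSeries m a (min i n) := by
  funext x
  rw [partialSumFun_levelSeries, levelSeries]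
  refine (Finset.sum_subset_zero_on_sdiff (Finset.range_mono (min_le_right i n))
    (fun j hj => ?_) fun j hj => ?_).symm
  · have hij : M m i ≤ M m j := M_strictMono.monotone (by
      simp only [Finset.mem_sdiff, Finset.mem_range] at hj
      omega)
    rw [min_eq_left hij, min_eq_left (hij.trans (M_strictMono.monotone j.le_succ)), sub_self,
      Pi.zero_apply, mul_zero]
  · have hji : j + 1 ≤ i := by
      simp only [Finset.mem_range] at hj
      omega
    rw [min_eq_right (M_strictMono.monotone hji),
      min_eq_right (M_strictMono.monotone (j.le_succ.trans hji))]

theorem martingale_levelSeries (a : ℕ → ℂ) :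
    Martingale (levelSeries m a) (filtration m) (μ m) :=
  martingale_iff_partialSumFun_eq.2 ⟨integrable_levelSeries a, partialSumFun_M_levelSeries a⟩

theorem partialSum_levelSeries_M_add (a : ℕ → ℂ) {N q : ℕ} (hq : q ≤ M m N) (x : G m) :
    partialSum m (M m N + q) (levelSeries m a) x =
      levelSeries m a N x + a N * (psi m (M m N) x * dirichletKernel m q x) := by
  have hle : M m N + q ≤ M m (N + 1) := by have := two_mul_M_le (m := m) N; omega
  have hkernel := dirichletKernel_mul_M_add 1 N hq x
  rw [one_mul] at hkernel
  rw [partialSum_eq_partialSumFun (martingale_levelSeries a) hle, partialSumFun_levelSeries,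
    Finset.sum_range_succ, min_eq_left hle, min_eq_right (Nat.le_add_right _ _), Pi.sub_apply,
    hkernel, add_sub_cancel_left, levelSeries]
  congr 1
  refine Finset.sum_congr rfl fun j hj => ?_
  have hj' {i : ℕ} (hi : i ≤ N) : min (M m N + q) (M m i) = M m i :=
    min_eq_right ((M_strictMono.monotone hi).trans (Nat.le_add_right _ _))
  rw [hj' (Finset.mem_range.1 hj), hj' (Finset.mem_range.1 hj).le]

theorem eLpNorm_partialSum_levelSeries_sub (a : ℕ → ℂ) {N q : ℕ} (hq : q ≤ M m N) :
    eLpNorm (partialSum m (M m N + q) (levelSeries m a) - partialSum m (M m N) (levelSeries m a))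
      1 (μ m) = ‖a N‖ₑ * eLpNorm (dirichletKernel m q) 1 (μ m) := by
  have hzero (x : G m) : partialSum m (M m N) (levelSeries m a) x = levelSeries m a N x := by
    simpa [dirichletKernel] using partialSum_levelSeries_M_add a (Nat.zero_le (M m N)) x
  have hdiff : partialSum m (M m N + q) (levelSeries m a) - partialSum m (M m N) (levelSeries m a) =
      a N • fun x => psi m (M m N) x * dirichletKernel m q x := by
    funext x
    rw [Pi.sub_apply, partialSum_levelSeries_M_add a hq, hzero, add_sub_cancel_left,
      Pi.smul_apply, smul_eq_mul]
  rw [hdiff, eLpNorm_const_smul]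
  congr 1
  exact eLpNorm_congr_norm_ae (ae_of_all _ fun x => by rw [norm_mul, norm_psi, one_mul])

theorem hardyNorm_levelSeries_sub_le (a : ℕ → ℂ) (n : ℕ) :
    hardyNorm m (fun k => levelSeries m a k - levelSeries m a (min k n)) ≤
      2 * ∑' j, ‖a (n + j)‖ₑ := by
  let Δ (j : ℕ) : G m → ℂ := dirichletKernel m (M m (j + 1)) - dirichletKernel m (M m j)
  have hΔ (j : ℕ) : Measurable fun x => ‖Δ j x‖ₑ :=
    ((measurable_dirichletKernel m _).sub (measurable_dirichletKernel m _)).enorm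
  calc hardyNorm m (fun k => levelSeries m a k - levelSeries m a (min k n))
      ≤ ∫⁻ x, ∑' j, ‖a (n + j)‖ₑ * ‖Δ (n + j) x‖ₑ ∂μ m :=
        lintegral_mono fun x => iSup_le fun k => enorm_levelSeries_sub_le a n k x
    _ = ∑' j, ‖a (n + j)‖ₑ * ∫⁻ x, ‖Δ (n + j) x‖ₑ ∂μ m := by
        rw [lintegral_tsum fun j => ((hΔ _).const_mul _).aemeasurable]
        simp only [lintegral_const_mul _ (hΔ _)]
    _ ≤ ∑' j, ‖a (n + j)‖ₑ * 2 := by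
        gcongr with j
        exact lintegral_enorm_dirichletKernel_M_sub_le (n + j)
    _ = 2 * ∑' j, ‖a (n + j)‖ₑ := by rw [ENNReal.tsum_mul_right, mul_comm]

theorem memHardy_levelSeries (ha : ∑' j, ‖a j‖ₑ ≠ ∞) : MemHardy m (levelSeries m a) := by
  refine ⟨martingale_levelSeries a, ?_⟩
  have hnorm := hardyNorm_levelSeries_sub_le (m := m) a 0
  have hzero : levelSeries m a 0 = 0 := funext fun _ => Finset.sum_range_zero _
  simp only [Nat.min_zero, hzero, sub_zero, zero_add] at hnorm
  exact hnorm.trans_lt (ENNReal.mul_lt_top ENNReal.ofNat_lt_top ha.lt_top)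

theorem modulus_levelSeries_le (a : ℕ → ℂ) (n : ℕ) :
    modulus m n (levelSeries m a) ≤ 2 * ∑' j, ‖a (n + j)‖ₑ := by
  rw [modulus_eq_hardyNorm (martingale_levelSeries a)]
  exact hardyNorm_levelSeries_sub_le a n

end LevelSeries

section Lacunary

/-- The coefficients `a_j = 1 / M_k` at the levels `j = 2 M_k`, and `a_j = 0` at the other levels,
for which `levelSeries m (lacunaryCoeff m)` is the counterexample. -/
noncomputable def lacunaryCoeff (m : ℕ → ℕ) : ℕ → ℂ :=
  Function.extend (fun k => 2 * M m k) (fun k => (M m k : ℂ)⁻¹) 0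

theorem enorm_inv_M [∀ k, NeZero (m k)] (k : ℕ) : ‖(M m k : ℂ)⁻¹‖ₑ = (M m k : ℝ≥0∞)⁻¹ := by
  rw [enorm_inv (NeZero.ne _), ← ofReal_norm, Complex.norm_natCast, ENNReal.ofReal_natCast]

variable [∀ k, (m k).AtLeastTwo]

theorem strictMono_two_mul_M : StrictMono fun k => 2 * M m k :=
  M_strictMono.const_mul two_pos

theorem lacunaryCoeff_two_mul_M (k : ℕ) : lacunaryCoeff m (2 * M m k) = (M m k : ℂ)⁻¹ :=
  strictMono_two_mul_M.injective.extend_apply _ _ k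

theorem enorm_lacunaryCoeff (j : ℕ) : ‖lacunaryCoeff m j‖ₑ =
    Function.extend (fun k => 2 * M m k) (fun k => (M m k : ℝ≥0∞)⁻¹) 0 j := by
  rw [lacunaryCoeff, Function.apply_extend enorm]
  congr! 1
  · exact funext enorm_inv_M
  · exact funext fun _ => enorm_zero

theorem two_pow_mul_M_le (n j : ℕ) : 2 ^ j * M m n ≤ M m (n + j) := by
  induction j with
  | zero => simp
  | succ j ih =>
    calc 2 ^ (j + 1) * M m n = 2 * (2 ^ j * M m n) := by ring
      _ ≤ 2 * M m (n + j) := Nat.mul_le_mul_left _ ih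
      _ ≤ M m (n + (j + 1)) := two_mul_M_le _

theorem tsum_inv_M_le (n : ℕ) : ∑' k, (M m (n + k) : ℝ≥0∞)⁻¹ ≤ 2 * (M m n : ℝ≥0∞)⁻¹ := by
  calc ∑' k, (M m (n + k) : ℝ≥0∞)⁻¹ ≤ ∑' k, (2⁻¹ : ℝ≥0∞) ^ k * (M m n : ℝ≥0∞)⁻¹ := by
        refine ENNReal.tsum_le_tsum fun k => ?_
        rw [← ENNReal.inv_pow, ← ENNReal.mul_inv (Or.inl (by simp)) (Or.inl (by simp)),
          ENNReal.inv_le_inv]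
        exact_mod_cast two_pow_mul_M_le n k
    _ = 2 * (M m n : ℝ≥0∞)⁻¹ := by
        rw [ENNReal.tsum_mul_right, ENNReal.tsum_geometric, ENNReal.one_sub_inv_two, inv_inv]

theorem tsum_enorm_lacunaryCoeff_add_le (n : ℕ) :
    ∑' j, ‖lacunaryCoeff m (2 * M m n + j)‖ₑ ≤ 2 * (M m n : ℝ≥0∞)⁻¹ := by
  simp only [enorm_lacunaryCoeff]
  rw [tsum_extend_strictMono_add strictMono_two_mul_M]
  exact tsum_inv_M_le n

theorem tsum_enorm_lacunaryCoeff_ne_top : ∑' j, ‖lacunaryCoeff m j‖ₑ ≠ ∞ := by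
  simp only [enorm_lacunaryCoeff]
  rw [tsum_extend_zero strictMono_two_mul_M.injective]
  refine ne_top_of_le_ne_top (b := 2) ENNReal.ofNat_ne_top ?_
  simpa [M] using tsum_inv_M_le (m := m) 0

theorem modulus_lacunary_isBigO :
    (fun n => (modulus m (2 * M m n) (levelSeries m (lacunaryCoeff m))).toReal) =O[atTop]
      fun n : ℕ => 1 / (M m n : ℝ) := by
  refine IsBigO.of_bound 4 (Eventually.of_forall fun n => ?_)
  have hle : modulus m (2 * M m n) (levelSeries m (lacunaryCoeff m)) ≤ 4 * (M m n : ℝ≥0∞)⁻¹ :=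
    calc modulus m (2 * M m n) (levelSeries m (lacunaryCoeff m))
        ≤ 2 * ∑' j, ‖lacunaryCoeff m (2 * M m n + j)‖ₑ := modulus_levelSeries_le _ _
      _ ≤ 2 * (2 * (M m n : ℝ≥0∞)⁻¹) := by
        gcongr
        exact tsum_enorm_lacunaryCoeff_add_le n
      _ = 4 * (M m n : ℝ≥0∞)⁻¹ := by rw [← mul_assoc]; norm_num
  have hfin : 4 * (M m n : ℝ≥0∞)⁻¹ ≠ ∞ :=
    ENNReal.mul_ne_top ENNReal.ofNat_ne_top (ENNReal.inv_ne_top.2 (NeZero.ne _))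
  rw [Real.norm_of_nonneg ENNReal.toReal_nonneg, Real.norm_of_nonneg (by positivity), one_div]
  simpa using ENNReal.toReal_mono hfin hle

theorem inv_four_le_eLpNorm_partialSum_lacunary_sub (k : ℕ) :
    4⁻¹ ≤ eLpNorm (partialSum m (M m (2 * M m k) + alternatingIndex m (M m k))
        (levelSeries m (lacunaryCoeff m)) -
      partialSum m (M m (2 * M m k)) (levelSeries m (lacunaryCoeff m))) 1 (μ m) := by
  rw [eLpNorm_partialSum_levelSeries_sub _ (alternatingIndex_lt _).le, lacunaryCoeff_two_mul_M,
    enorm_inv_M]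
  calc (4⁻¹ : ℝ≥0∞) = (M m k : ℝ≥0∞)⁻¹ * (M m k * 4⁻¹) := by
        rw [← mul_assoc, ENNReal.inv_mul_cancel (NeZero.ne _) (ENNReal.natCast_ne_top _), one_mul]
    _ ≤ _ := by
        gcongr
        exact le_eLpNorm_dirichletKernel_alternatingIndex _

theorem not_tendsto_partialSum_lacunary {F : G m → ℂ} (hF : AEStronglyMeasurable F (μ m)) :
    ¬ Tendsto (fun k => eLpNorm (partialSum m k (levelSeries m (lacunaryCoeff m)) - F) 1 (μ m))
      atTop (𝓝 0) := by
  intro h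
  have hψ : Tendsto (fun k => M m (2 * M m k)) atTop atTop :=
    (M_strictMono.comp strictMono_two_mul_M).tendsto_atTop
  have hφ : Tendsto (fun k => M m (2 * M m k) + alternatingIndex m (M m k)) atTop atTop :=
    tendsto_atTop_mono (fun k => Nat.le_add_right _ _) hψ
  have hmeas (n : ℕ) : AEStronglyMeasurable
      (partialSum m n (levelSeries m (lacunaryCoeff m))) (μ m) :=
    (integrable_finsetSum _ fun i _ => (integrable_psi i).const_mul _).1
  have hle : (4⁻¹ : ℝ≥0∞) ≤ 0 := ge_of_tendsto'
    (tendsto_eLpNorm_sub_comp le_rfl hmeas hF h hφ hψ) inv_four_le_eLpNorm_partialSum_lacunary_sub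
  simp at hle

end Lacunary

end Vilenkin

open Vilenkin in
theorem theorem4_general (m : ℕ → ℕ) (hm : ∀ k, 2 ≤ m k) :
    (∀ f : ℕ → G m → ℂ, MemHardy m f →
      (fun n => (modulus m n f).toReal) =o[atTop]
        (fun n : ℕ => 1 / (∑ j ∈ Finset.range (n + 1), m j : ℝ)) →
      Represents m (limit m f) f ∧
        Tendsto (fun k => eLpNorm (fun x => partialSum m k f x - limit m f x) 1 (μ m))
          atTop (𝓝 0)) ∧
    (∃ f : ℕ → G m → ℂ, MemHardy m f ∧
      (∀ n, modulus m n f < ∞) ∧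
      (fun n => (modulus m (2 * M m n) f).toReal) =O[atTop] (fun n : ℕ => 1 / (M m n : ℝ)) ∧
      Represents m (limit m f) f ∧
      ¬ Tendsto (fun k => eLpNorm (fun x => partialSum m k f x - limit m f x) 1 (μ m))
          atTop (𝓝 0)) := by
  have (k : ℕ) : (m k).AtLeastTwo := ⟨hm k⟩
  constructor
  · exact fun f hf ho => ⟨represents_limit hf, tendsto_partialSum_of_modulus_isLittleO hf ho⟩
  · have hf : MemHardy m (levelSeries m (lacunaryCoeff m)) :=
      memHardy_levelSeries tsum_enorm_lacunaryCoeff_ne_top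
    have hF := represents_limit hf
    exact ⟨_, hf, modulus_lt_top hf, modulus_lacunary_isBigO, hF,
      not_tendsto_partialSum_lacunary hF.1.1⟩

open Vilenkin in
theorem theorem4 (m : ℕ → ℕ) (hm : ∀ k, 2 ≤ m k) :
    ((∃ B, ∀ k, m k ≤ B) →
      ∀ f : ℕ → G m → ℂ, MemHardy m f →
        (fun n => (modulus m n f).toReal) =o[atTop] (fun n : ℕ => 1 / (n : ℝ)) →
        Represents m (limit m f) f ∧
          Tendsto (fun k => eLpNorm (fun x => partialSum m k f x - limit m f x) 1 (μ m))
            atTop (𝓝 0)) ∧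
    (∃ f : ℕ → G m → ℂ, MemHardy m f ∧
      (∀ n, modulus m n f < ∞) ∧
      (fun n => (modulus m (2 * M m n) f).toReal) =O[atTop] (fun n : ℕ => 1 / (M m n : ℝ)) ∧
      Represents m (limit m f) f ∧
      ¬ Tendsto (fun k => eLpNorm (fun x => partialSum m k f x - limit m f x) 1 (μ m))
          atTop (𝓝 0)) := by
  have (k : ℕ) : (m k).AtLeastTwo := ⟨hm k⟩
  exact (theorem4_general m hm).imp_left fun h ⟨_, hB⟩ f hf ho =>
    h f hf (ho.trans_isBigO (one_div_isBigO_one_div_sum hB))
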